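/- Throughout, $m,n,k$ denote positive integers and $\mathbb{R}^m$ carries its Euclidean structure. A map $\varphi:\mathbb{R}^m\to\mathbb{R}^n$ is a *harmonic morphism* if for every open $U\subseteq\mathbb{R}^n$ and every harmonic $f:U\to\mathbb{R}$ the function $f\circ\varphi$ is harmonic on $\varphi^{-1}(U)$. Let $H_2(m,n)$ be the set of *quadratic harmonic morphisms*: the non-zero harmonic morphisms $\varphi=(\varphi^1,\dots,\varphi^n):\mathbb{R}^m\to\mathbb{R}^n$ all of whose components are quadratic forms. Let $C(2m,n)$ be the set of *Clifford systems*: the $n$-tuples $(P_1,\dots,P_n)$ of symmetric endomorphisms of $\mathbb{R}^{2m}$ with $P_iP_j+P_jP_i=2\delta_{ij}\,\mathrm{Id}$ for all $i,j$. Let $O(m,n)$ be the set of *O-systems*: the $n$-tuples $(\tau_1,\dots,\tau_n)$ of orthogonal endomorphisms of $\mathbb{R}^{m}$ with $\tau_i^t\tau_j+\tau_j^t\tau_i=2\delta_{ij}\,\mathrm{Id}$ for all $i,j$. An element of $H_2(m,n)$ is *range-maximal* if $n$ is the largest integer with $H_2(m,n)\neq\emptyset$ for the given $m$, and *domain-minimal*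 if $m$ is the smallest positive integer with $H_2(m,n)\neq\emptyset$ for the given $n$. The same words are used for $C(2m,n)$ and for $O(m,n)$. **Theorem (range-extendability).** 1. Let $\varphi\in H_2(m,n)$ be domain-minimal and not range-maximal. Then there are $k>n$ and a range-maximal $\psi\in H_2(m,k)$ with $\psi^i=\varphi^i$ for $1\le i\le n$. 2. Let $(P_1,\dots,P_n)\in C(2m,n)$ be domain-minimal and not range-maximal; if $n=1$, assume moreover that $\operatorname{tr}P_1=0$, i.e. that the quadratic form $X\mapsto\langle P_1X,X\rangle$ is harmonic (for $n\ge2$ all $\operatorname{tr}P_i$ vanish automatically). Then there are $k>n$ and endomorphisms $P_{n+1},\dots,P_k$ of $\mathbb{R}^{2m}$ such that $(P_1,\dots,P_k)\in C(2m,k)$ is range-maximal. 3. Let $(\tau_1,\dots,\tau_n)\in O(m,n)$ be domain-minimal and not range-maximal. Then there are $k>n$ and endomorphisms $\tau_{n+1},\dots,\tau_k$ of $\mathbb{R}^{m}$ such that $(\tau_1,\dots,\tau_k)\in O(m,k)$ is range-maximal. -/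

import Mathlib

/-- A map between Euclidean spaces is a harmonic morphism if it pulls back harmonic functions,
defined on open subsets of the target, to harmonic functions. -/
def IsHarmonicMorphism {m n : ℕ}
    (φ : EuclideanSpace ℝ (Fin m) → EuclideanSpace ℝ (Fin n)) : Prop :=
  ∀ (U : Set (EuclideanSpace ℝ (Fin n))) (f : EuclideanSpace ℝ (Fin n) → ℝ), IsOpen U →
    InnerProductSpace.HarmonicOnNhd f U →
    InnerProductSpace.HarmonicOnNhd (f ∘ φ) (φ ⁻¹' U)

/-! Quadratic harmonic morphisms -/

/-- The set `H₂(m, n)` of (nonconstant) quadratic harmonic morphisms `ℝᵐ → ℝⁿ`: harmonic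
morphisms whose components are quadratic forms. The zero map is excluded, since otherwise every
`H₂(m, n)` would be nonempty. -/
def QuadraticHarmonicMorphisms (m n : ℕ) :
    Set (EuclideanSpace ℝ (Fin m) → EuclideanSpace ℝ (Fin n)) :=
  {φ | IsHarmonicMorphism φ ∧
    (∀ i : Fin n, ∃ Q : QuadraticForm ℝ (EuclideanSpace ℝ (Fin m)), ∀ x, φ x i = Q x) ∧
    φ ≠ 0}

/-- `φ ∈ H₂(m, n)`, and `n` is the largest range dimension with `H₂(m, n) ≠ ∅`. -/
def QuadraticHarmonicMorphisms.IsRangeMaximal {m n : ℕ}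
    (φ : EuclideanSpace ℝ (Fin m) → EuclideanSpace ℝ (Fin n)) : Prop :=
  φ ∈ QuadraticHarmonicMorphisms m n ∧
    IsGreatest {k : ℕ | (QuadraticHarmonicMorphisms m k).Nonempty} n

/-- `φ ∈ H₂(m, n)`, and `m` is the smallest domain dimension with `H₂(m, n) ≠ ∅`. -/
def QuadraticHarmonicMorphisms.IsDomainMinimal {m n : ℕ}
    (φ : EuclideanSpace ℝ (Fin m) → EuclideanSpace ℝ (Fin n)) : Prop :=
  φ ∈ QuadraticHarmonicMorphisms m n ∧
    IsLeast {k : ℕ | (QuadraticHarmonicMorphisms k n).Nonempty} m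

/-! Clifford systems -/

/-- The set `C(2m, n)` of `(2m, n)`-dimensional Clifford systems: `n`-tuples of symmetric
endomorphisms of `ℝ²ᵐ` with `Pᵢ Pⱼ + Pⱼ Pᵢ = 2 δᵢⱼ Id`. -/
def CliffordSystems (m n : ℕ) :
    Set (Fin n → Module.End ℝ (EuclideanSpace ℝ (Fin (2 * m)))) :=
  {P | (∀ i, (P i).IsSymmetric) ∧
    ∀ i j, P i * P j + P j * P i = (if i = j then (2 : ℝ) else 0) • 1}

/-- `P ∈ C(2m, n)`, and `n` is the largest length of a Clifford system on `ℝ²ᵐ`. -/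
def CliffordSystems.IsRangeMaximal {m n : ℕ}
    (P : Fin n → Module.End ℝ (EuclideanSpace ℝ (Fin (2 * m)))) : Prop :=
  P ∈ CliffordSystems m n ∧ IsGreatest {k : ℕ | (CliffordSystems m k).Nonempty} n

/-- `P ∈ C(2m, n)`, and `2m` is the smallest positive dimension with `C(2m, n) ≠ ∅`. -/
def CliffordSystems.IsDomainMinimal {m n : ℕ}
    (P : Fin n → Module.End ℝ (EuclideanSpace ℝ (Fin (2 * m)))) : Prop :=
  P ∈ CliffordSystems m n ∧ IsLeast {k : ℕ | 0 < k ∧ (CliffordSystems k n).Nonempty} m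

/-! O-systems -/

/-- The set `O(m, n)` of `(m, n)`-dimensional O-systems: `n`-tuples of orthogonal
endomorphisms of `ℝᵐ` with `τᵢᵗ τⱼ + τⱼᵗ τᵢ = 2 δᵢⱼ Id`. -/
def OSystems (m n : ℕ) : Set (Fin n → Module.End ℝ (EuclideanSpace ℝ (Fin m))) :=
  {τ | (∀ i x, ‖τ i x‖ = ‖x‖) ∧
    ∀ i j, LinearMap.adjoint (τ i) * τ j + LinearMap.adjoint (τ j) * τ i =
      (if i = j then (2 : ℝ) else 0) • 1}

/-- `τ ∈ O(m, n)`, and `n` is the largest length of an O-system on `ℝᵐ`. -/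
def OSystems.IsRangeMaximal {m n : ℕ}
    (τ : Fin n → Module.End ℝ (EuclideanSpace ℝ (Fin m))) : Prop :=
  τ ∈ OSystems m n ∧ IsGreatest {k : ℕ | (OSystems m k).Nonempty} n

/-- `τ ∈ O(m, n)`, and `m` is the smallest positive dimension with `O(m, n) ≠ ∅`. -/
def OSystems.IsDomainMinimal {m n : ℕ}
    (τ : Fin n → Module.End ℝ (EuclideanSpace ℝ (Fin m))) : Prop :=
  τ ∈ OSystems m n ∧ IsLeast {k : ℕ | 0 < k ∧ (OSystems k n).Nonempty} m

set_option linter.unusedSectionVars false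

/-! Compressions of endomorphisms along isometric embeddings -/

section Compression

variable {E V : Type*} [NormedAddCommGroup E] [InnerProductSpace ℝ E] [FiniteDimensional ℝ E]
  [NormedAddCommGroup V] [InnerProductSpace ℝ V] [FiniteDimensional ℝ V]

/-! A domain-minimal system is irreducible: compressing it to a proper non-zero invariant subspace
would give a system of the same kind in a smaller dimension (for Clifford systems and harmonic
morphisms this needs n ≥ 2). The lengths possible on a fixed space are bounded, by
`card_le_of_anticommute`, so a system that is not range-maximal shares its space with one of maximal
length k > n. It remains to conjugate the first n members of the long system into the given ones.

Two irreducible Clifford families of equal length and dimension can be inequivalent because of a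
sign. Here the member of index n of the long system anticommutes with all earlier ones and absorbs
that sign, which yields a non-zero intertwiner (`exists_intertwiner`). A real Schur lemma makes it a
multiple of an isometry (`IsCliffordFamily.exists_linearIsometryEquiv`), and pulling the long system
back proves `IsCliffordFamily.exists_extension`. The sign ε treats symmetric Clifford systems and
the skew families τ₀ᵗτᵢ of O-systems at once.

For harmonic morphisms, testing against linear and quadratic harmonic functions turns the condition
into algebra: traceless symmetric Aᵢ with AᵢAⱼ + AⱼAᵢ = 2δᵢⱼS. Domain-minimality with n ≥ 2 forces S
to be a positive scalar, so that the Aᵢ are a rescaled irreducible Clifford system. The case n = 1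
takes place in a plane, where a quarter turn supplies a second member. -/

/-- The compression `e* ∘ A ∘ e` of an endomorphism along an isometric embedding. -/
noncomputable def compression (e : E →ₗᵢ[ℝ] V) (A : Module.End ℝ V) : Module.End ℝ E :=
  LinearMap.adjoint e.toLinearMap ∘ₗ A ∘ₗ e.toLinearMap

theorem inner_compression_left (e : E →ₗᵢ[ℝ] V) (A : Module.End ℝ V) (x y : E) :
    inner ℝ (compression e A x) y = inner ℝ (A (e x)) (e y) := by
  simp [compression, LinearMap.adjoint_inner_left]

theorem compression_eq_of_apply_eq {e : E →ₗᵢ[ℝ] V} {A : Module.End ℝ V} {x y : E}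
    (h : A (e x) = e y) : compression e A x = y := by
  refine ext_inner_right ℝ fun z => ?_
  rw [inner_compression_left, h, e.inner_map_map]

theorem apply_compression {e : E →ₗᵢ[ℝ] V} {A : Module.End ℝ V}
    (h : ∀ x, A (e x) ∈ LinearMap.range e.toLinearMap) (x : E) :
    e (compression e A x) = A (e x) := by
  obtain ⟨y, hy⟩ := h x
  rw [compression_eq_of_apply_eq (y := y) hy.symm]
  exact hy

/-- Only the inner factor has to preserve the range of `e`, since `e ∘ e*` is the identity there. -/
theorem compression_mul {e : E →ₗᵢ[ℝ] V} (A : Module.End ℝ V) {B : Module.End ℝ V}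
    (h : ∀ x, B (e x) ∈ LinearMap.range e.toLinearMap) :
    compression e A * compression e B = compression e (A * B) := by
  ext1 x
  refine ext_inner_right ℝ fun z => ?_
  simp [inner_compression_left, apply_compression h]

theorem compression_one (e : E →ₗᵢ[ℝ] V) : compression e 1 = 1 := by
  ext1 x
  exact compression_eq_of_apply_eq rfl

theorem compression_add (e : E →ₗᵢ[ℝ] V) (A B : Module.End ℝ V) :
    compression e (A + B) = compression e A + compression e B := by
  ext1 x; simp [compression]

theorem compression_smul (e : E →ₗᵢ[ℝ] V) (c : ℝ) (A : Module.End ℝ V) :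
    compression e (c • A) = c • compression e A := by
  ext1 x; simp [compression]

theorem adjoint_compression (e : E →ₗᵢ[ℝ] V) (A : Module.End ℝ V) :
    LinearMap.adjoint (compression e A) = compression e (LinearMap.adjoint A) := by
  simp [compression, LinearMap.adjoint_comp, LinearMap.comp_assoc]

/-- Domain-minimality only speaks of the spaces `EuclideanSpace ℝ (Fin d)`, so an invariant subspace
has to be replaced by an isometric copy of this form. -/
theorem Submodule.exists_linearIsometry_range_eq (U : Submodule ℝ V) :
    ∃ (d : ℕ) (e : EuclideanSpace ℝ (Fin d) →ₗᵢ[ℝ] V),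
      Module.finrank ℝ U = d ∧ LinearMap.range e.toLinearMap = U := by
  refine ⟨_, U.subtypeₗᵢ.comp (stdOrthonormalBasis ℝ U).repr.symm.toLinearIsometry, rfl, ?_⟩
  ext x
  constructor
  · rintro ⟨y, rfl⟩
    simp
  · intro hx
    exact ⟨(stdOrthonormalBasis ℝ U).repr ⟨x, hx⟩, by simp⟩

end Compression

/-! Families of anticommuting endomorphisms -/

section CliffordFamily

variable {ι κ : Type*} [DecidableEq ι] [DecidableEq κ]
  {E V W : Type*} [NormedAddCommGroup E] [InnerProductSpace ℝ E] [FiniteDimensional ℝ E]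
  [NormedAddCommGroup V] [InnerProductSpace ℝ V] [FiniteDimensional ℝ V]
  [NormedAddCommGroup W] [InnerProductSpace ℝ W] [FiniteDimensional ℝ W]

/-- Pairwise anticommuting endomorphisms `P i` with `P i ^ 2 = ε` and `(P i)* = ε P i`: symmetric
for `ε = 1`, skew-symmetric for `ε = -1`. -/
def IsCliffordFamily (ε : ℝ) (P : ι → Module.End ℝ V) : Prop :=
  (∀ i, LinearMap.adjoint (P i) = ε • P i) ∧
    ∀ i j, P i * P j + P j * P i = (if i = j then 2 * ε else 0) • 1

/-- A family of endomorphisms without proper non-zero invariant subspaces. -/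
def IsIrreducibleFamily (P : ι → Module.End ℝ V) : Prop :=
  ∀ U : Submodule ℝ V, (∀ i, ∀ x ∈ U, P i x ∈ U) → U = ⊥ ∨ U = ⊤

namespace IsCliffordFamily

variable {ε : ℝ} {P : ι → Module.End ℝ V}

theorem mul_self (h : IsCliffordFamily ε P) (i : ι) : P i * P i = ε • 1 := by
  have := h.2 i i
  rw [if_pos rfl, mul_smul, ← two_smul ℝ (P i * P i)] at this
  exact smul_right_injective _ two_ne_zero this

theorem apply_apply_self (h : IsCliffordFamily ε P) (i : ι) (x : V) : P i (P i x) = ε • x := by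
  simpa using LinearMap.congr_fun (h.mul_self i) x

theorem apply_apply_of_ne (h : IsCliffordFamily ε P) {i j : ι} (hij : i ≠ j) (x : V) :
    P i (P j x) = -P j (P i x) := by
  have := LinearMap.congr_fun (h.2 i j) x
  simp only [if_neg hij, zero_smul, LinearMap.add_apply, Module.End.mul_apply,
    LinearMap.zero_apply] at this
  exact eq_neg_of_add_eq_zero_left this

theorem comp_injective (h : IsCliffordFamily ε P) {f : κ → ι} (hf : Function.Injective f) :
    IsCliffordFamily ε (fun i => P (f i)) :=
  ⟨fun i => h.1 _, fun i j => by rw [h.2]; simp [hf.eq_iff]⟩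

theorem compression (h : IsCliffordFamily ε P) (e : E →ₗᵢ[ℝ] V)
    (he : ∀ i x, P i (e x) ∈ LinearMap.range e.toLinearMap) :
    IsCliffordFamily ε (fun i => compression e (P i)) := by
  refine ⟨fun i => ?_, fun i j => ?_⟩
  · rw [adjoint_compression, h.1, compression_smul]
  · rw [compression_mul _ (he j), compression_mul _ (he i), ← compression_add, h.2,
      compression_smul, compression_one]

end IsCliffordFamily

/-- Non-zero multiples of anticommuting square roots of one endomorphism are independent. -/
theorem linearIndependent_of_anticommute {A : ι → Module.End ℝ V} {S : Module.End ℝ V}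
    (hS : S ≠ 0) (h : ∀ i j, A i * A j + A j * A i = (if i = j then (2 : ℝ) else 0) • S) :
    LinearIndependent ℝ A := by
  rw [linearIndependent_iff']
  intro s g hg i hi
  -- The anticommutator with `A i` kills every term of a linear relation except the `i`-th, which
  -- isolates its coefficient.
  have h1 : (∑ j ∈ s, g j • A j) * A i + A i * (∑ j ∈ s, g j • A j) = (2 * g i) • S := by
    rw [Finset.sum_mul, Finset.mul_sum, ← Finset.sum_add_distrib]
    have : ∀ j ∈ s, g j • A j * A i + A i * g j • A j
        = if j = i then (2 * g i) • S else 0 := by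
      intro j _
      rw [smul_mul_assoc, mul_smul_comm, ← smul_add, h, smul_smul]
      by_cases hji : j = i
      · subst hji; simp [mul_comm]
      · simp [hji]
    rw [Finset.sum_congr rfl this, Finset.sum_ite_eq' s i, if_pos hi]
  rw [hg, zero_mul, mul_zero, add_zero] at h1
  rcases smul_eq_zero.mp h1.symm with h2 | h2
  · linarith
  · exact absurd h2 hS

theorem card_le_of_anticommute [Fintype ι] {A : ι → Module.End ℝ V} {S : Module.End ℝ V}
    (hS : S ≠ 0) (h : ∀ i j, A i * A j + A j * A i = (if i = j then (2 : ℝ) else 0) • S) :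
    Fintype.card ι ≤ Module.finrank ℝ (Module.End ℝ V) :=
  (linearIndependent_of_anticommute hS h).fintype_card_le_finrank

theorem IsCliffordFamily.card_le [Fintype ι] [Nontrivial V] {ε : ℝ} (hε : ε ≠ 0)
    {P : ι → Module.End ℝ V} (h : IsCliffordFamily ε P) :
    Fintype.card ι ≤ Module.finrank ℝ (Module.End ℝ V) := by
  refine card_le_of_anticommute (A := P) (S := ε • 1) (smul_ne_zero hε one_ne_zero) fun i j => ?_
  rw [h.2, smul_smul, ite_mul, zero_mul]

/-- If a Clifford family on `W` can be prolonged by one more endomorphism, then it receives a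
non-zero intertwiner from every Clifford family of the same length. -/
theorem exists_intertwiner [Fintype ι] [Nontrivial V] [Nontrivial W] {ε : ℝ} (hε : ε * ε = 1)
    {P : ι → Module.End ℝ V} {P' : ι → Module.End ℝ W} {Q : Module.End ℝ W}
    (hP : IsCliffordFamily ε P) (hP' : IsCliffordFamily ε P')
    (hQ : ∀ i x, Q (P' i x) = -P' i (Q x)) (hQQ : ∀ x, Q (Q x) = ε • x) :
    ∃ T : V →ₗ[ℝ] W, T ≠ 0 ∧ ∀ i x, T (P i x) = P' i (T x) := by
  have hε0 : ε ≠ 0 := by rintro rfl; simp at hε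
  suffices H : ∀ s : Finset ι, ∃ T : V →ₗ[ℝ] W, T ≠ 0 ∧ ∀ i ∈ s, ∀ x, T (P i x) = P' i (T x) by
    obtain ⟨T, hT, h⟩ := H Finset.univ
    exact ⟨T, hT, fun i => h i (Finset.mem_univ i)⟩
  intro s
  induction s using Finset.induction_on with
  | empty =>
    obtain ⟨T, hT⟩ := exists_ne (0 : V →ₗ[ℝ] W)
    exact ⟨T, hT, by simp⟩
  | insert j s hj ih =>
    obtain ⟨T, hT, h⟩ := ih
    -- The average `T + ε P'ⱼ T Pⱼ` intertwines at `j` because ε² = 1, and it still intertwines at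
    -- the earlier indices. If it vanishes, `T` anti-intertwines at `j`. Then `Q P'ⱼ T` repairs the
    -- sign: `Q P'ⱼ` is invertible, anticommutes with `P'ⱼ`, and commutes with the other `P'ᵢ` since
    -- both factors anticommute with them.
    by_cases h0 : ε • (P' j ∘ₗ T ∘ₗ P j) = -T
    · refine ⟨Q ∘ₗ P' j ∘ₗ T, ?_, ?_⟩
      · intro hz
        apply hT
        ext x
        have h1 := congrArg (P' j) (congrArg Q (LinearMap.congr_fun hz x))
        simpa [hQQ, hP'.apply_apply_self, hε0] using h1
      · have hj' : ∀ x, T (P j x) = -P' j (T x) := fun x => by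
          have h1 := congrArg (P' j) (LinearMap.congr_fun h0 x)
          simpa [hP'.apply_apply_self, smul_smul, hε] using h1
        intro i hi x
        rcases Finset.mem_insert.mp hi with rfl | hi
        · simp [hj', hQ]
        · have hij : i ≠ j := fun h => hj (h ▸ hi)
          simp [h i hi, hQ, hP'.apply_apply_of_ne hij]
    · refine ⟨T + ε • (P' j ∘ₗ T ∘ₗ P j), fun hz => h0 (eq_neg_of_add_eq_zero_right hz), ?_⟩
      intro i hi x
      rcases Finset.mem_insert.mp hi with rfl | hi
      · simp [hP.apply_apply_self, hP'.apply_apply_self, smul_smul, hε, add_comm]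
      · have hij : i ≠ j := fun h => hj (h ▸ hi)
        simp [h i hi, hP.apply_apply_of_ne hij.symm, hP'.apply_apply_of_ne hij]

/-- A real form of Schur's lemma: a symmetric endomorphism commuting with an irreducible family
is a scalar. -/
theorem IsIrreducibleFamily.exists_eq_smul_one [Nontrivial V] {P : ι → Module.End ℝ V}
    (hP : IsIrreducibleFamily P) {S : Module.End ℝ V} (hS : S.IsSymmetric)
    (h : ∀ i x, S (P i x) = P i (S x)) : ∃ c : ℝ, S = c • 1 := by
  -- A symmetric endomorphism has a real eigenvalue, the supremum of its Rayleigh quotient, and the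
  -- commutation makes its eigenspace invariant.
  have hc := hS.hasEigenvalue_iSup_of_finiteDimensional
  set c := _
  change Module.End.HasEigenvalue S c at hc
  refine ⟨c, ?_⟩
  rcases hP (Module.End.eigenspace S c) (fun i x hx => by
    rw [Module.End.mem_eigenspace_iff] at hx ⊢
    rw [h, hx, map_smul]) with h0 | h0
  · exact absurd h0 hc
  · ext1 x
    have : x ∈ Module.End.eigenspace S c := h0 ▸ Submodule.mem_top
    simpa [Module.End.mem_eigenspace_iff] using this

/-- Since `(P i)* = ε P i` on both sides, the adjoint of an intertwiner `T` is an intertwiner too.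
So `T*T` commutes with the irreducible family, hence is a scalar c > 0, and `T/√c` is isometric. -/
theorem IsCliffordFamily.exists_linearIsometryEquiv [Fintype ι] [Nontrivial V] {ε : ℝ}
    (hε : ε * ε = 1) (hVW : Module.finrank ℝ V = Module.finrank ℝ W)
    {P : ι → Module.End ℝ V} {P' : ι → Module.End ℝ W} {Q : Module.End ℝ W}
    (hP : IsCliffordFamily ε P) (hirr : IsIrreducibleFamily P) (hP' : IsCliffordFamily ε P')
    (hQ : ∀ i x, Q (P' i x) = -P' i (Q x)) (hQQ : ∀ x, Q (Q x) = ε • x) :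
    ∃ e : V ≃ₗᵢ[ℝ] W, ∀ i x, e (P i x) = P' i (e x) := by
  have hε0 : ε ≠ 0 := by rintro rfl; simp at hε
  have : Nontrivial W := by
    apply Module.nontrivial_of_finrank_pos (R := ℝ)
    rw [← hVW]; exact Module.finrank_pos
  obtain ⟨T, hT, h⟩ := exists_intertwiner hε hP hP' hQ hQQ
  have hadj : ∀ i y, LinearMap.adjoint T (P' i y) = P i (LinearMap.adjoint T y) := by
    intro i y
    refine ext_inner_right ℝ fun z => ?_
    have h1 : ∀ z, inner ℝ (P' i y) z = ε * inner ℝ y (P' i z) := fun z => by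
      rw [← LinearMap.adjoint_inner_right, hP'.1, LinearMap.smul_apply, inner_smul_right]
    have h2 : ∀ x, inner ℝ (P i x) z = ε * inner ℝ x (P i z) := fun x => by
      rw [← LinearMap.adjoint_inner_right, hP.1, LinearMap.smul_apply, inner_smul_right]
    rw [LinearMap.adjoint_inner_left, h1, h2, LinearMap.adjoint_inner_left, h]
  obtain ⟨c, hc⟩ := hirr.exists_eq_smul_one (S := LinearMap.adjoint T ∘ₗ T)
    T.isSymmetric_adjoint_comp_self (fun i x => by simp [h, hadj])
  have hnorm : ∀ x, ‖T x‖ ^ 2 = c * ‖x‖ ^ 2 := fun x => by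
    have := congrArg (fun y => inner ℝ y x) (LinearMap.congr_fun hc x)
    simpa [LinearMap.adjoint_inner_left, real_inner_self_eq_norm_sq, inner_smul_left] using this
  have hc0 : 0 < c := by
    obtain ⟨x, hx⟩ : ∃ x, T x ≠ 0 := by
      by_contra! hcon
      exact hT (LinearMap.ext hcon)
    have h1 : 0 < ‖T x‖ ^ 2 := by positivity
    rw [hnorm] at h1
    exact pos_of_mul_pos_left h1 (by positivity)
  let e₀ : V →ₗᵢ[ℝ] W := ⟨(√c)⁻¹ • T, fun x => by
    have h1 : ‖T x‖ = √c * ‖x‖ := by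
      rw [← Real.sqrt_sq (norm_nonneg (T x)), hnorm, Real.sqrt_mul hc0.le,
        Real.sqrt_sq (norm_nonneg x)]
    have h2 : 0 < √c := Real.sqrt_pos.mpr hc0
    rw [LinearMap.smul_apply, norm_smul, h1, norm_inv, Real.norm_of_nonneg h2.le]
    field_simp⟩
  refine ⟨e₀.toLinearIsometryEquiv hVW, fun i x => ?_⟩
  change (√c)⁻¹ • T (P i x) = P' i ((√c)⁻¹ • T x)
  rw [h, map_smul]

/-- An irreducible Clifford family extends to the length of any longer Clifford family on a space
of the same dimension. -/
theorem IsCliffordFamily.exists_extension [Nontrivial V] {ε : ℝ} (hε : ε * ε = 1) {n k : ℕ}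
    (hnk : n < k) {P : Fin n → Module.End ℝ V} {P' : Fin k → Module.End ℝ V}
    (hP : IsCliffordFamily ε P) (hirr : IsIrreducibleFamily P) (hP' : IsCliffordFamily ε P') :
    ∃ R : Fin k → Module.End ℝ V, IsCliffordFamily ε R ∧
      ∀ i : Fin n, R (Fin.castLE hnk.le i) = P i := by
  -- Indices start at 0, so `P' ⟨n, hnk⟩` is the first member outside the truncation to length n. It
  -- plays the role of `Q`.
  obtain ⟨e, he⟩ := hP.exists_linearIsometryEquiv hε rfl hirr
    (hP'.comp_injective (Fin.castLE_injective hnk.le)) (Q := P' ⟨n, hnk⟩)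
    (fun i x => hP'.apply_apply_of_ne (by simp [Fin.ext_iff, i.2.ne']) x)
    (fun x => hP'.apply_apply_self _ x)
  have hrange : ∀ y, y ∈ LinearMap.range e.toLinearIsometry.toLinearMap :=
    fun y => ⟨e.symm y, e.apply_symm_apply y⟩
  refine ⟨fun j => _root_.compression e.toLinearIsometry (P' j),
    hP'.compression e.toLinearIsometry (fun _ _ => hrange _), fun i => ?_⟩
  ext1 x
  exact compression_eq_of_apply_eq (he i x).symm

/-- An endomorphism anticommuting with an automorphism is traceless. -/
theorem trace_eq_zero_of_anticommute {A B : Module.End ℝ V} (hB : IsUnit B)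
    (h : A * B + B * A = 0) : LinearMap.trace ℝ V A = 0 := by
  obtain ⟨u, rfl⟩ := hB
  have h1 : (u : Module.End ℝ V) * A * ↑u⁻¹ = -A := by
    rw [← neg_eq_of_add_eq_zero_right h, neg_mul, mul_assoc, Units.mul_inv, mul_one]
  have h2 := congrArg (LinearMap.trace ℝ V) h1
  rw [LinearMap.trace_mul_comm, ← mul_assoc, Units.inv_mul, one_mul, map_neg] at h2
  linarith

/-- In odd dimension (det J)² = det(-1) = -1 would be negative. -/
theorem even_finrank_of_mul_self_eq_neg_one {J : Module.End ℝ V} (hJ : J * J = -1) :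
    Even (Module.finrank ℝ V) := by
  by_contra hodd
  rw [Nat.not_even_iff_odd] at hodd
  have h1 := congrArg LinearMap.det hJ
  have h2 : LinearMap.det (-1 : Module.End ℝ V) = -1 := by
    have := LinearMap.det_smul (-1 : ℝ) (1 : Module.End ℝ V)
    simpa [hodd.neg_one_pow] using this
  rw [map_mul, h2] at h1
  nlinarith [mul_self_nonneg (LinearMap.det J)]

end CliffordFamily

/-! Traceless symmetric endomorphisms of the plane -/

theorem toEuclideanLin_mul {n : Type*} [Fintype n] [DecidableEq n] (N N' : Matrix n n ℝ) :
    Matrix.toEuclideanLin N * Matrix.toEuclideanLin N' = Matrix.toEuclideanLin (N * N') :=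
  (Matrix.toLpLin_mul_same 2 N N').symm

theorem trace_toEuclideanLin_fin_two (N : Matrix (Fin 2) (Fin 2) ℝ) :
    LinearMap.trace ℝ _ (Matrix.toEuclideanLin N) = N 0 0 + N 1 1 := by
  rw [Matrix.toEuclideanLin, Matrix.toLpLin_eq_toLin,
    LinearMap.trace_eq_matrix_trace ℝ (PiLp.basisFun 2 ℝ (Fin 2)), LinearMap.toMatrix_toLin,
    Matrix.trace_fin_two]

/-- A traceless symmetric endomorphism of the plane has an anticommuting companion. -/
theorem exists_anticommuting_of_trace_eq_zero (A : Module.End ℝ (EuclideanSpace ℝ (Fin 2)))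
    (hA : A.IsSymmetric) (htr : LinearMap.trace ℝ _ A = 0) :
    ∃ B : Module.End ℝ (EuclideanSpace ℝ (Fin 2)), B.IsSymmetric ∧ LinearMap.trace ℝ _ B = 0 ∧
      A * B + B * A = 0 ∧ B * B = A * A := by
  obtain ⟨M, rfl⟩ := (Matrix.toEuclideanLin (𝕜 := ℝ) (m := Fin 2) (n := Fin 2)).surjective A
  rw [Matrix.isSymmetric_toEuclideanLin_iff] at hA
  rw [trace_toEuclideanLin_fin_two] at htr
  have h10 : M 1 0 = M 0 1 := by simpa using hA.apply 0 1
  have h11 : M 1 1 = -M 0 0 := by linarith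
  -- This is the quarter turn composed with `M`. The quarter turn anticommutes with every traceless
  -- symmetric matrix of size two.
  refine ⟨Matrix.toEuclideanLin !![-M 0 1, M 0 0; M 0 0, M 0 1], ?_, ?_, ?_, ?_⟩
  · rw [Matrix.isSymmetric_toEuclideanLin_iff]
    ext i j
    fin_cases i <;> fin_cases j <;> simp
  · rw [trace_toEuclideanLin_fin_two]; simp
  · rw [toEuclideanLin_mul, toEuclideanLin_mul, ← map_add, LinearEquiv.map_eq_zero_iff]
    ext i j
    fin_cases i <;> fin_cases j <;>
      simp [Matrix.mul_apply, Matrix.vecMul, dotProduct, Fin.sum_univ_two, h10, h11, mul_comm]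
  · rw [toEuclideanLin_mul, toEuclideanLin_mul]
    congr 1
    ext i j
    fin_cases i <;> fin_cases j <;>
      simp [Matrix.mul_apply, Fin.sum_univ_two, h10, h11, mul_comm, add_comm]

/-! Range-extendability of Clifford systems -/

theorem exists_gt_isGreatest {s : Set ℕ} {n : ℕ} (hn : n ∈ s) (hs : BddAbove s)
    (h : ¬ IsGreatest s n) : ∃ k, n < k ∧ IsGreatest s k := by
  have hg : IsGreatest s (sSup s) := ⟨Nat.sSup_mem ⟨n, hn⟩ hs, fun _ h => le_csSup hs h⟩
  refine ⟨sSup s, lt_of_le_of_ne (hg.2 hn) ?_, hg⟩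
  intro hne
  exact h (hne ▸ hg)

theorem EuclideanSpace.nontrivial_fin {m : ℕ} (hm : 0 < m) :
    Nontrivial (EuclideanSpace ℝ (Fin m)) :=
  Module.nontrivial_of_finrank_pos (R := ℝ) (by simpa using hm)

namespace CliffordSystems

theorem mem_iff {m n : ℕ} {P : Fin n → Module.End ℝ (EuclideanSpace ℝ (Fin (2 * m)))} :
    P ∈ CliffordSystems m n ↔ IsCliffordFamily 1 P := by
  simp only [CliffordSystems, IsCliffordFamily, Set.mem_ofPred_eq, one_smul, mul_one,
    LinearMap.isSymmetric_iff_isSelfAdjoint, LinearMap.isSelfAdjoint_iff']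

theorem bddAbove {m : ℕ} (hm : 0 < m) : BddAbove {k : ℕ | (CliffordSystems m k).Nonempty} := by
  have := EuclideanSpace.nontrivial_fin (m := 2 * m) (by omega)
  refine ⟨Module.finrank ℝ (Module.End ℝ (EuclideanSpace ℝ (Fin (2 * m)))), ?_⟩
  rintro k ⟨P, hP⟩
  simpa using (mem_iff.mp hP).card_le one_ne_zero

theorem IsDomainMinimal.exists_gt {m n : ℕ}
    {P : Fin n → Module.End ℝ (EuclideanSpace ℝ (Fin (2 * m)))}
    (h : IsDomainMinimal P) (hP : ¬ IsRangeMaximal P) :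
    ∃ k, n < k ∧ IsGreatest {k : ℕ | (CliffordSystems m k).Nonempty} k :=
  exists_gt_isGreatest ⟨P, h.1⟩ (bddAbove h.2.1.1) fun hg => hP ⟨h.1, hg⟩

/-- Clifford systems are defined only in even dimensions, so an invariant subspace contradicts
minimality only once its dimension is known to be even. This is where two members are needed: their
product squares to -1. -/
theorem IsDomainMinimal.isIrreducibleFamily {m n : ℕ} (hn : 2 ≤ n)
    {P : Fin n → Module.End ℝ (EuclideanSpace ℝ (Fin (2 * m)))}
    (h : IsDomainMinimal P) : IsIrreducibleFamily P := by
  intro U hU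
  obtain ⟨d, e, hd, he⟩ := U.exists_linearIsometry_range_eq
  have hc := (mem_iff.mp h.1).compression e fun i x => by
    rw [he]; exact hU i _ (he.le ⟨x, rfl⟩)
  have heven : Even d := by
    have h2 := even_finrank_of_mul_self_eq_neg_one
      (J := compression e (P ⟨0, by omega⟩) * compression e (P ⟨1, by omega⟩)) (by
        ext1 x
        simp only [Module.End.mul_apply]
        rw [hc.apply_apply_of_ne (by simp), hc.apply_apply_self, one_smul, hc.apply_apply_self]
        simp)
    simpa using h2
  obtain ⟨d, rfl⟩ := heven.two_dvd
  rcases Nat.eq_zero_or_pos d with rfl | hd0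
  · exact Or.inl (Submodule.finrank_eq_zero.mp (by simpa using hd))
  · right
    have hle := h.2.2 ⟨hd0, _, mem_iff.mpr hc⟩
    apply Submodule.eq_top_of_finrank_eq
    apply le_antisymm U.finrank_le
    rw [hd]
    simpa using hle

/-- A domain-minimal Clifford system of length at least two extends to the maximal length. -/
theorem IsDomainMinimal.exists_extension_of_two_le {m n : ℕ} (hn : 2 ≤ n)
    {P : Fin n → Module.End ℝ (EuclideanSpace ℝ (Fin (2 * m)))}
    (h : IsDomainMinimal P) (hP : ¬ IsRangeMaximal P) :
    ∃ (k : ℕ) (h : n < k) (R : Fin k → Module.End ℝ (EuclideanSpace ℝ (Fin (2 * m)))),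
      IsRangeMaximal R ∧ ∀ i : Fin n, R (Fin.castLE h.le i) = P i := by
  obtain ⟨k, hk, hg⟩ := h.exists_gt hP
  obtain ⟨P', hP'⟩ := hg.1
  have := EuclideanSpace.nontrivial_fin (m := 2 * m) (by have := h.2.1.1; omega)
  obtain ⟨R, hR, hRP⟩ := (mem_iff.mp h.1).exists_extension (one_mul 1) hk
    (h.isIrreducibleFamily hn) (mem_iff.mp hP')
  exact ⟨k, hk, R, ⟨mem_iff.mpr hR, hg⟩, hRP⟩

theorem IsDomainMinimal.exists_extension {m n : ℕ}
    {P : Fin n → Module.End ℝ (EuclideanSpace ℝ (Fin (2 * m)))}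
    (htr : n = 1 → ∀ i, LinearMap.trace ℝ (EuclideanSpace ℝ (Fin (2 * m))) (P i) = 0)
    (h : IsDomainMinimal P) (hP : ¬ IsRangeMaximal P) :
    ∃ (k : ℕ) (h : n < k) (R : Fin k → Module.End ℝ (EuclideanSpace ℝ (Fin (2 * m)))),
      IsRangeMaximal R ∧ ∀ i : Fin n, R (Fin.castLE h.le i) = P i := by
  rcases Nat.lt_or_ge n 2 with hn | hn
  swap
  · exact h.exists_extension_of_two_le hn hP
  interval_cases n
  · obtain ⟨k, hk, hg⟩ := h.exists_gt hP
    obtain ⟨P', hP'⟩ := hg.1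
    exact ⟨k, hk, P', ⟨hP', hg⟩, fun i => i.elim0⟩
  -- The constant family at the identity is a Clifford system of length one on the plane, so m = 1.
  -- The trace hypothesis excludes P = ± Id, which anticommutes with no invertible endomorphism.
  · have hm : m = 1 := by
      refine le_antisymm (h.2.2 ⟨one_pos, fun _ => 1, mem_iff.mpr ⟨fun i => ?_, fun i j => ?_⟩⟩)
        h.2.1.1
      · rw [one_smul]
        exact LinearMap.adjoint_id
      · rw [Subsingleton.elim i j, if_pos rfl]
        module
    subst hm
    obtain ⟨B, hB, -, hAB, hBB⟩ := exists_anticommuting_of_trace_eq_zero (P 0)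
      (h.1.1 0) (htr rfl 0)
    have hAA : P 0 * P 0 = 1 := by simpa using (mem_iff.mp h.1).mul_self 0
    have hmem : ![P 0, B] ∈ CliffordSystems 1 2 := by
      refine ⟨fun i => ?_, fun i j => ?_⟩
      · fin_cases i
        · exact h.1.1 0
        · exact hB
      · fin_cases i <;> fin_cases j <;> simp [hBB, hAA, hAB, add_comm (B * P 0), two_smul]
    by_cases hmax : IsRangeMaximal ![P 0, B]
    · exact ⟨2, by norm_num, _, hmax, fun i => by rw [Subsingleton.elim i 0]; rfl⟩
    -- The pair is again domain-minimal, as no positive m lies below 1, so the case of length two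
    -- applies.
    · obtain ⟨k, hk, R, hR, hRP⟩ := IsDomainMinimal.exists_extension_of_two_le le_rfl
        ⟨hmem, ⟨one_pos, _, hmem⟩, fun _ hd => hd.1⟩ hmax
      refine ⟨k, by omega, R, hR, fun i => ?_⟩
      rw [Subsingleton.elim i 0]
      exact hRP 0

end CliffordSystems

/-! Range-extendability of O-systems -/

namespace OSystems

variable {m n : ℕ}

theorem adjoint_mul_self {τ : Fin n → Module.End ℝ (EuclideanSpace ℝ (Fin m))}
    (h : τ ∈ OSystems m n) (i : Fin n) : LinearMap.adjoint (τ i) * τ i = 1 := by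
  have := h.2 i i
  rw [if_pos rfl, ← two_smul ℝ] at this
  exact smul_right_injective _ two_ne_zero this

theorem mul_adjoint_self {τ : Fin n → Module.End ℝ (EuclideanSpace ℝ (Fin m))}
    (h : τ ∈ OSystems m n) (i : Fin n) : τ i * LinearMap.adjoint (τ i) = 1 :=
  mul_eq_one_comm.mp (adjoint_mul_self h i)

/-- The endomorphisms `τ₀ᵗ τᵢ` with `i ≥ 1` of an O-system are skew and anticommute. -/
theorem isCliffordFamily {τ : Fin (n + 1) → Module.End ℝ (EuclideanSpace ℝ (Fin m))}
    (h : τ ∈ OSystems m (n + 1)) :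
    IsCliffordFamily (-1) (fun i : Fin n => LinearMap.adjoint (τ 0) * τ i.succ) := by
  have hskew : ∀ i : Fin n, LinearMap.adjoint (τ 0) * τ i.succ
      = -(LinearMap.adjoint (τ i.succ) * τ 0) := fun i => by
    have := h.2 0 i.succ
    rw [if_neg (Fin.succ_ne_zero i).symm, zero_smul] at this
    exact eq_neg_of_add_eq_zero_left this
  have hadj : ∀ A B : Module.End ℝ (EuclideanSpace ℝ (Fin m)),
      LinearMap.adjoint (A * B) = LinearMap.adjoint B * LinearMap.adjoint A :=
    fun A B => LinearMap.adjoint_comp A B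
  have hprod : ∀ i j : Fin n, LinearMap.adjoint (τ 0) * τ i.succ *
      (LinearMap.adjoint (τ 0) * τ j.succ) = -(LinearMap.adjoint (τ i.succ) * τ j.succ) :=
    fun i j => by
      rw [hskew i, neg_mul, mul_assoc, ← mul_assoc (τ 0), mul_adjoint_self h, one_mul]
  refine ⟨fun i => ?_, fun i j => ?_⟩
  · change LinearMap.adjoint (LinearMap.adjoint (τ 0) * τ i.succ) =
      (-1 : ℝ) • (LinearMap.adjoint (τ 0) * τ i.succ)
    rw [hadj, LinearMap.adjoint_adjoint, hskew, neg_one_smul, neg_neg]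
  · rw [hprod, hprod, ← neg_add, h.2]
    by_cases hij : i = j <;> simp [hij]

/-- Prepending an orthogonal endomorphism `σ` to the `σ Jᵢ` makes an O-system of a skew Clifford
family. -/
theorem cons_mem {σ : Module.End ℝ (EuclideanSpace ℝ (Fin m))}
    (hσ : LinearMap.adjoint σ * σ = 1) {J : Fin n → Module.End ℝ (EuclideanSpace ℝ (Fin m))}
    (hJ : IsCliffordFamily (-1) J) :
    (Fin.cons σ fun i => σ * J i : Fin (n + 1) → _) ∈ OSystems m (n + 1) := by
  have hadj : ∀ i, LinearMap.adjoint (σ * J i) = -(J i * LinearMap.adjoint σ) := fun i => by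
    rw [show LinearMap.adjoint (σ * J i) = LinearMap.adjoint (J i) * LinearMap.adjoint σ from
      LinearMap.adjoint_comp σ (J i), hJ.1, neg_one_smul, neg_mul]
  have hrel : ∀ i j : Fin (n + 1),
      LinearMap.adjoint ((Fin.cons σ fun i => σ * J i : Fin (n + 1) → _) i) *
        (Fin.cons σ fun i => σ * J i : Fin (n + 1) → _) j +
      LinearMap.adjoint ((Fin.cons σ fun i => σ * J i : Fin (n + 1) → _) j) *
        (Fin.cons σ fun i => σ * J i : Fin (n + 1) → _) i = (if i = j then (2 : ℝ) else 0) • 1 := by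
    have h1 : ∀ A B : Module.End ℝ (EuclideanSpace ℝ (Fin m)),
        A * LinearMap.adjoint σ * (σ * B) = A * B := fun A B => by
      rw [mul_assoc, ← mul_assoc _ σ B, hσ, one_mul]
    intro i j
    refine Fin.cases ?_ (fun i => ?_) i <;> refine Fin.cases ?_ (fun j => ?_) j
    · simp [hσ, two_smul]
    · rw [Fin.cons_zero, Fin.cons_succ, hadj, ← mul_assoc, hσ, neg_mul, mul_assoc, hσ,
        if_neg (Fin.succ_ne_zero j).symm]
      simp
    · rw [Fin.cons_zero, Fin.cons_succ, hadj, ← mul_assoc, hσ, neg_mul, mul_assoc, hσ,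
        if_neg (Fin.succ_ne_zero i)]
      simp
    · rw [Fin.cons_succ, Fin.cons_succ, hadj, hadj, neg_mul, neg_mul, h1, h1, ← neg_add, hJ.2]
      by_cases hij : i = j <;> simp [hij]
  refine ⟨fun i x => ?_, hrel⟩
  have h2 := LinearMap.congr_fun (hrel i i) x
  rw [if_pos rfl, ← two_smul ℝ] at h2
  have h3 := smul_right_injective _ (two_ne_zero' ℝ) h2
  have h4 := congrArg (fun y => inner ℝ y x) h3
  simp only [Module.End.mul_apply, LinearMap.adjoint_inner_left, real_inner_self_eq_norm_sq,
    Module.End.one_apply] at h4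
  exact (sq_eq_sq₀ (norm_nonneg _) (norm_nonneg _)).mp h4

theorem bddAbove (hm : 0 < m) : BddAbove {k : ℕ | (OSystems m k).Nonempty} := by
  have := EuclideanSpace.nontrivial_fin hm
  -- The summand 1 accounts for `τ 0`, which is used up in forming the skew family.
  refine ⟨Module.finrank ℝ (Module.End ℝ (EuclideanSpace ℝ (Fin m))) + 1, ?_⟩
  rintro k ⟨τ, hτ⟩
  cases k with
  | zero => exact Nat.zero_le _
  | succ k =>
    have := (isCliffordFamily hτ).card_le (by norm_num)
    rw [Fintype.card_fin] at this
    exact Nat.succ_le_succ this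

/-- Compress the skew family to an invariant subspace, then prepend the identity to recover an
O-system of the original length there. -/
theorem IsDomainMinimal.isIrreducibleFamily
    {τ : Fin (n + 1) → Module.End ℝ (EuclideanSpace ℝ (Fin m))} (h : IsDomainMinimal τ) :
    IsIrreducibleFamily (fun i : Fin n => LinearMap.adjoint (τ 0) * τ i.succ) := by
  intro U hU
  obtain ⟨d, e, hd, he⟩ := U.exists_linearIsometry_range_eq
  have hc := (isCliffordFamily h.1).compression e fun i x => by
    rw [he]; exact hU i _ (he.le ⟨x, rfl⟩)
  rcases Nat.eq_zero_or_pos d with rfl | hd0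
  · exact Or.inl (Submodule.finrank_eq_zero.mp hd)
  · right
    have hle := h.2.2 ⟨hd0, _, cons_mem (σ := 1) (by rw [mul_one]; exact LinearMap.adjoint_id) hc⟩
    apply Submodule.eq_top_of_finrank_eq
    apply le_antisymm U.finrank_le
    rw [hd]
    simpa using hle

theorem IsDomainMinimal.exists_extension
    {τ : Fin n → Module.End ℝ (EuclideanSpace ℝ (Fin m))}
    (h : IsDomainMinimal τ) (hτ : ¬ IsRangeMaximal τ) :
    ∃ (k : ℕ) (h : n < k) (ρ : Fin k → Module.End ℝ (EuclideanSpace ℝ (Fin m))),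
      IsRangeMaximal ρ ∧ ∀ i : Fin n, ρ (Fin.castLE h.le i) = τ i := by
  obtain ⟨k, hk, hg⟩ := exists_gt_isGreatest (s := {k : ℕ | (OSystems m k).Nonempty})
    ⟨τ, h.1⟩ (bddAbove h.2.1.1) fun hg => hτ ⟨h.1, hg⟩
  obtain ⟨τ', hτ'⟩ := hg.1
  have := EuclideanSpace.nontrivial_fin h.2.1.1
  cases n with
  | zero => exact ⟨k, hk, τ', ⟨hτ', hg⟩, fun i => i.elim0⟩
  | succ n =>
    obtain ⟨k, rfl⟩ : ∃ l, k = l + 1 := ⟨k - 1, by omega⟩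
    obtain ⟨R, hR, hRJ⟩ := (isCliffordFamily h.1).exists_extension (by norm_num)
      (Nat.lt_of_succ_lt_succ hk) h.isIrreducibleFamily (isCliffordFamily hτ')
    -- Multiplying the extended skew family by `τ 0` gives back the original members, because τ₀τ₀ᵗ
    -- = 1.
    refine ⟨k + 1, hk, _, ⟨cons_mem (adjoint_mul_self h.1 0) hR, hg⟩, fun i => ?_⟩
    refine Fin.cases ?_ (fun i => ?_) i
    · simp
    · rw [Fin.castLE_succ, Fin.cons_succ, hRJ, ← mul_assoc, mul_adjoint_self h.1, one_mul]

end OSystems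

open scoped Laplacian

/-! The Laplacian of a composition -/

section Laplacian

variable {E F G : Type*} [NormedAddCommGroup E] [InnerProductSpace ℝ E] [FiniteDimensional ℝ E]
  [NormedAddCommGroup F] [NormedSpace ℝ F] [NormedAddCommGroup G] [NormedSpace ℝ G]

theorem iteratedFDeriv_two_comp {f : F → G} {g : E → F} {x : E} (hf : ContDiffAt ℝ 2 f (g x))
    (hg : ContDiffAt ℝ 2 g x) (v : E) :
    iteratedFDeriv ℝ 2 (f ∘ g) x ![v, v] =
      iteratedFDeriv ℝ 2 f (g x) ![fderiv ℝ g x v, fderiv ℝ g x v] +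
        fderiv ℝ f (g x) (iteratedFDeriv ℝ 2 g x ![v, v]) := by
  simp only [iteratedFDeriv_two_apply, Matrix.cons_val_zero, Matrix.cons_val_one]
  have hg1 : ∀ᶠ y in nhds x, DifferentiableAt ℝ g y :=
    (hg.eventually (by simp)).mono fun y hy => hy.differentiableAt two_ne_zero
  have hf1 : ∀ᶠ y in nhds x, DifferentiableAt ℝ f (g y) :=
    hg.continuousAt.eventually
      ((hf.eventually (by simp)).mono fun y hy => hy.differentiableAt two_ne_zero)
  have heq : fderiv ℝ (f ∘ g) =ᶠ[nhds x] fun y => (fderiv ℝ f (g y)).comp (fderiv ℝ g y) := by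
    filter_upwards [hg1, hf1] with y h1 h2
    exact fderiv_comp y h2 h1
  have hdf : DifferentiableAt ℝ (fderiv ℝ f) (g x) :=
    (hf.fderiv_right (m := 1) (by norm_num)).differentiableAt one_ne_zero
  have hdg : DifferentiableAt ℝ (fderiv ℝ g) x :=
    (hg.fderiv_right (m := 1) (by norm_num)).differentiableAt one_ne_zero
  have hder := (hdf.hasFDerivAt.comp x (hg.differentiableAt two_ne_zero).hasFDerivAt).clm_comp
    hdg.hasFDerivAt
  rw [heq.fderiv_eq]
  simp only [Function.comp_apply] at hder
  rw [hder.fderiv]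
  simp [add_comm]

/-- Trace of the second-order chain rule. The first term sees only how the differential of `g`
distorts lengths, the second only the Laplacian of `g`. -/
theorem laplacian_comp {f : F → G} {g : E → F} {x : E} (hf : ContDiffAt ℝ 2 f (g x))
    (hg : ContDiffAt ℝ 2 g x) {ι : Type*} [Fintype ι] (b : OrthonormalBasis ι ℝ E) :
    Δ (f ∘ g) x =
      ∑ a, iteratedFDeriv ℝ 2 f (g x) ![fderiv ℝ g x (b a), fderiv ℝ g x (b a)] +
        fderiv ℝ f (g x) (Δ g x) := by
  simp only [InnerProductSpace.laplacian_eq_iteratedFDeriv_orthonormalBasis _ b,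
    iteratedFDeriv_two_comp hf hg, Finset.sum_add_distrib, map_sum]

end Laplacian

/-! Quadratic functions -/

section Quadratic

variable {E : Type*} [NormedAddCommGroup E] [InnerProductSpace ℝ E] [FiniteDimensional ℝ E]

theorem hasFDerivAt_inner_apply_self (C : Module.End ℝ E) (x : E) :
    HasFDerivAt (fun y => inner ℝ (C y) y)
      (innerSL ℝ (C x + LinearMap.adjoint C x)) x := by
  have h := (LinearMap.toContinuousLinearMap C).hasFDerivAt (x := x) |>.inner ℝ (hasFDerivAt_id x)
  refine h.congr_fderiv ?_
  ext v
  simp [LinearMap.adjoint_inner_left, real_inner_comm]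

theorem contDiff_inner_apply_self (C : Module.End ℝ E) :
    ContDiff ℝ 2 (fun y : E => inner ℝ (C y) y) :=
  (LinearMap.toContinuousLinearMap C).contDiff.inner ℝ contDiff_id

theorem iteratedFDeriv_two_inner_apply_self (C : Module.End ℝ E) (x v : E) :
    iteratedFDeriv ℝ 2 (fun y => inner ℝ (C y) y) x ![v, v] = 2 * inner ℝ (C v) v := by
  have h1 : fderiv ℝ (fun y => inner ℝ (C y) y) =
      ⇑((innerSL ℝ) ∘L LinearMap.toContinuousLinearMap (C + LinearMap.adjoint C)) := by
    ext1 y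
    rw [(hasFDerivAt_inner_apply_self C y).fderiv]
    rfl
  rw [iteratedFDeriv_two_apply, h1, ContinuousLinearMap.fderiv]
  change inner ℝ ((C + LinearMap.adjoint C) v) v = _
  rw [LinearMap.add_apply, inner_add_left, LinearMap.adjoint_inner_left,
    real_inner_comm (C v) v, two_mul]

theorem laplacian_inner_apply_self (C : Module.End ℝ E) (x : E) :
    Δ (fun y => inner ℝ (C y) y) x = 2 * LinearMap.trace ℝ E C := by
  rw [InnerProductSpace.laplacian_eq_iteratedFDeriv_stdOrthonormalBasis,
    LinearMap.trace_eq_sum_inner C (stdOrthonormalBasis ℝ E), Finset.mul_sum]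
  exact Finset.sum_congr rfl fun a _ => by
    rw [iteratedFDeriv_two_inner_apply_self, real_inner_comm]

theorem harmonicAt_inner_apply_self {C : Module.End ℝ E} (hC : LinearMap.trace ℝ E C = 0)
    (x : E) : InnerProductSpace.HarmonicAt (fun y => inner ℝ (C y) y) x := by
  refine ⟨(contDiff_inner_apply_self C).contDiffAt, Filter.Eventually.of_forall fun y => ?_⟩
  rw [laplacian_inner_apply_self, hC, mul_zero]
  rfl

end Quadratic


/-! ### Quadratic maps and the algebraic form of the harmonic morphism condition -/

section QuadraticMap

variable {E : Type*} [NormedAddCommGroup E] [InnerProductSpace ℝ E] [FiniteDimensional ℝ E]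
  {n : ℕ}

/-- The map with components `x ↦ ⟪A i x, x⟫`. -/
noncomputable def quadraticMap (A : Fin n → Module.End ℝ E) (x : E) : EuclideanSpace ℝ (Fin n) :=
  WithLp.toLp 2 fun i => inner ℝ (A i x) x

theorem quadraticMap_apply (A : Fin n → Module.End ℝ E) (x : E) (i : Fin n) :
    quadraticMap A x i = inner ℝ (A i x) x := rfl

theorem contDiff_quadraticMap (A : Fin n → Module.End ℝ E) : ContDiff ℝ 2 (quadraticMap A) :=
  contDiff_euclidean.mpr fun i => contDiff_inner_apply_self (A i)

theorem fderiv_quadraticMap {A : Fin n → Module.End ℝ E} (hA : ∀ i, (A i).IsSymmetric)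
    (x v : E) (i : Fin n) : fderiv ℝ (quadraticMap A) x v i = 2 * inner ℝ (A i x) v := by
  have h1 : HasFDerivAt (quadraticMap A) (fderiv ℝ (quadraticMap A) x) x :=
    ((contDiff_quadraticMap A).differentiable two_ne_zero x).hasFDerivAt
  have h2 := ((EuclideanSpace.proj i : EuclideanSpace ℝ (Fin n) →L[ℝ] ℝ).hasFDerivAt.comp x
    h1).unique (hasFDerivAt_inner_apply_self (A i) x)
  have h3 := DFunLike.congr_fun h2 v
  rw [(hA i).adjoint_eq, ← two_smul ℝ, map_smul] at h3
  exact h3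

theorem laplacian_quadraticMap (A : Fin n → Module.End ℝ E) (x : E) (i : Fin n) :
    Δ (quadraticMap A) x i = 2 * LinearMap.trace ℝ E (A i) := by
  rw [← laplacian_inner_apply_self (A i) x]
  exact ((contDiff_quadraticMap A).contDiffAt.laplacian_CLM_comp_left
    (l := (EuclideanSpace.proj i : EuclideanSpace ℝ (Fin n) →L[ℝ] ℝ))).symm

/-- Symmetric traceless endomorphisms `A i` with `A i * A j + A j * A i = 2 δᵢⱼ S`, where `S ≠ 0`:
the data of a quadratic harmonic morphism. -/
structure IsHarmonicFamily (A : Fin n → Module.End ℝ E) (S : Module.End ℝ E) : Prop where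
  ne_zero : S ≠ 0
  isSymmetric : ∀ i, (A i).IsSymmetric
  trace_eq_zero : ∀ i, LinearMap.trace ℝ E (A i) = 0
  anticommute : ∀ i j, A i * A j + A j * A i = (if i = j then (2 : ℝ) else 0) • S

namespace IsHarmonicFamily

variable {A : Fin n → Module.End ℝ E} {S : Module.End ℝ E}

theorem mul_self (h : IsHarmonicFamily A S) (i : Fin n) : A i * A i = S := by
  have := h.anticommute i i
  rw [if_pos rfl, ← two_smul ℝ] at this
  exact smul_right_injective _ two_ne_zero this

theorem inner_apply_apply (h : IsHarmonicFamily A S) (i j : Fin n) (x : E) :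
    inner ℝ (A i x) (A j x) = if i = j then inner ℝ (S x) x else 0 := by
  have h1 := congrArg (fun y => inner ℝ y x) (LinearMap.congr_fun (h.anticommute i j) x)
  simp only [LinearMap.add_apply, Module.End.mul_apply, LinearMap.smul_apply, inner_add_left,
    inner_smul_left] at h1
  rw [h.isSymmetric i (A j x) x, h.isSymmetric j (A i x) x, real_inner_comm (A i x) (A j x)] at h1
  split_ifs at h1 ⊢ with hij <;> simp at h1 <;> linarith

theorem commute (h : IsHarmonicFamily A S) (i : Fin n) : S * A i = A i * S := by
  rw [← h.mul_self i, mul_assoc]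

theorem isSymmetric_square (h : IsHarmonicFamily A S) (hn : 0 < n) : S.IsSymmetric := by
  intro x y
  rw [← h.mul_self ⟨0, hn⟩]
  simp only [Module.End.mul_apply]
  rw [h.isSymmetric, h.isSymmetric]

/-- The relations say that the components are harmonic and that their gradients 2Aᵢy are orthogonal
of common squared length 4⟨Sy, y⟩. The chain rule then gives Δ(f ∘ φ) = 4⟨Sy, y⟩ (Δf) ∘ φ. -/
theorem isHarmonicMorphism {m : ℕ} {A : Fin n → Module.End ℝ (EuclideanSpace ℝ (Fin m))}
    {S : Module.End ℝ (EuclideanSpace ℝ (Fin m))} (h : IsHarmonicFamily A S) :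
    IsHarmonicMorphism (quadraticMap A) := by
  intro U f hU hf x hx
  have hφ : ContDiff ℝ 2 (quadraticMap A) := contDiff_quadraticMap A
  refine ⟨(hf _ hx).1.comp x hφ.contDiffAt, ?_⟩
  filter_upwards [hφ.continuous.continuousAt.preimage_mem_nhds (hU.mem_nhds hx)] with y hy
  obtain ⟨hfc, hfΔ⟩ := hf _ hy
  rw [laplacian_comp hfc hφ.contDiffAt (stdOrthonormalBasis ℝ _)]
  have hΔ : Δ (quadraticMap A) y = 0 := by
    ext i
    rw [laplacian_quadraticMap, h.trace_eq_zero, mul_zero]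
    rfl
  have hfΔ' := hfΔ.eq_of_nhds
  rw [InnerProductSpace.laplacian_eq_iteratedFDeriv_orthonormalBasis f
    (EuclideanSpace.basisFun (Fin n) ℝ)] at hfΔ'
  simp only [iteratedFDeriv_two_apply, Matrix.cons_val_zero, Matrix.cons_val_one] at hfΔ' ⊢
  set H := fderiv ℝ (fderiv ℝ f) (quadraticMap A y)
  set b := stdOrthonormalBasis ℝ (EuclideanSpace ℝ (Fin m))
  set u := EuclideanSpace.basisFun (Fin n) ℝ with hu
  have hD : ∀ v, fderiv ℝ (quadraticMap A) y v = ∑ i, (2 * inner ℝ (A i y) v) • u i := fun v => by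
    rw [← u.sum_repr (fderiv ℝ (quadraticMap A) y v)]
    refine Finset.sum_congr rfl fun i _ => ?_
    rw [hu, EuclideanSpace.basisFun_repr, fderiv_quadraticMap h.isSymmetric]
  have hsum : ∑ a, H (fderiv ℝ (quadraticMap A) y (b a)) (fderiv ℝ (quadraticMap A) y (b a)) =
      4 * inner ℝ (S y) y * ∑ i, H (u i) (u i) := by
    calc _ = ∑ a, ∑ i, ∑ j, 4 * (inner ℝ (A i y) (b a) * inner ℝ (b a) (A j y)) *
          (H (u i) (u j) : ℝ) := by
          refine Finset.sum_congr rfl fun a _ => ?_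
          simp only [hD, map_sum, map_smul, sum_apply, smul_eq_mul,
            FunLike.coe_smul, Pi.smul_apply]
          rw [Finset.sum_comm]
          refine Finset.sum_congr rfl fun i _ => ?_
          rw [Finset.mul_sum]
          refine Finset.sum_congr rfl fun j _ => ?_
          rw [real_inner_comm (A i y) (b a)]
          ring
      _ = ∑ i, ∑ j, 4 * inner ℝ (A i y) (A j y) * H (u i) (u j) := by
          rw [Finset.sum_comm]
          refine Finset.sum_congr rfl fun i _ => ?_
          rw [Finset.sum_comm]
          refine Finset.sum_congr rfl fun j _ => ?_
          rw [← Finset.sum_mul, ← Finset.mul_sum, b.sum_inner_mul_inner]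
      _ = _ := by
          simp only [h.inner_apply_apply, mul_ite, ite_mul, mul_zero, zero_mul,
            Finset.sum_ite_eq, Finset.mem_univ, if_true, Finset.mul_sum]
  rw [hsum, hΔ, hfΔ']
  simp

end IsHarmonicFamily

/-- The endomorphism `y ↦ yⱼ uᵢ`. -/
noncomputable def elementaryEnd (i j : Fin n) : Module.End ℝ (EuclideanSpace ℝ (Fin n)) :=
  LinearMap.smulRight (EuclideanSpace.proj j : EuclideanSpace ℝ (Fin n) →L[ℝ] ℝ).toLinearMap
    (EuclideanSpace.single i 1)

theorem inner_elementaryEnd (i j : Fin n) (y : EuclideanSpace ℝ (Fin n)) :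
    inner ℝ (elementaryEnd i j y) y = y j * y i := by
  simp [elementaryEnd, inner_smul_left, EuclideanSpace.inner_single_left]

theorem trace_elementaryEnd (i j : Fin n) :
    LinearMap.trace ℝ _ (elementaryEnd i j) = if i = j then 1 else 0 := by
  rw [elementaryEnd, LinearMap.trace_smulRight]
  simp [eq_comm]

/-- Harmonic test functions determine the relations satisfied by a quadratic harmonic morphism. -/
theorem IsHarmonicMorphism.isHarmonicFamily {m : ℕ}
    {A : Fin n → Module.End ℝ (EuclideanSpace ℝ (Fin m))} (hA : ∀ i, (A i).IsSymmetric)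
    (h : IsHarmonicMorphism (quadraticMap A)) (i₀ : Fin n) (hne : A i₀ * A i₀ ≠ 0) :
    IsHarmonicFamily A (A i₀ * A i₀) := by
  -- Test functions: the coordinates of the target.
  have htr : ∀ i, LinearMap.trace ℝ _ (A i) = 0 := by
    intro i
    have h1 : InnerProductSpace.HarmonicOnNhd
        (EuclideanSpace.proj i : EuclideanSpace ℝ (Fin n) →L[ℝ] ℝ) Set.univ := by
      refine fun y _ => ⟨ContinuousLinearMap.contDiff _ |>.contDiffAt,
        Filter.Eventually.of_forall fun z => ?_⟩
      have hfd : fderiv ℝ (EuclideanSpace.proj i : EuclideanSpace ℝ (Fin n) →L[ℝ] ℝ) =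
          fun _ => (EuclideanSpace.proj i : EuclideanSpace ℝ (Fin n) →L[ℝ] ℝ) := by
        ext1 y; exact ContinuousLinearMap.fderiv _
      rw [InnerProductSpace.laplacian_eq_iteratedFDeriv_stdOrthonormalBasis]
      simp only [iteratedFDeriv_two_apply, hfd, fderiv_fun_const]
      simp
    have h2 := (h Set.univ _ isOpen_univ h1 0 (Set.mem_univ _)).2.eq_of_nhds
    rw [(contDiff_quadraticMap A).contDiffAt.laplacian_CLM_comp_left] at h2
    have h3 : Δ (quadraticMap A) 0 i = 0 := h2
    rw [laplacian_quadraticMap] at h3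
    linarith
  -- Test functions: the quadratic forms ⟨Cy, y⟩ with `C` traceless. Below, `C` is chosen so that
  -- they are yᵢyⱼ with i ≠ j, and yᵢ² - yⱼ².
  have hkey : ∀ C : Module.End ℝ (EuclideanSpace ℝ (Fin n)), LinearMap.trace ℝ _ C = 0 → ∀ x,
      ∑ a, inner ℝ (C (fderiv ℝ (quadraticMap A) x (stdOrthonormalBasis ℝ _ a)))
        (fderiv ℝ (quadraticMap A) x (stdOrthonormalBasis ℝ _ a)) = 0 := by
    intro C hC x
    have h2 := (h Set.univ _ isOpen_univ (fun y _ => harmonicAt_inner_apply_self hC y) x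
      (Set.mem_univ _)).2.eq_of_nhds
    have hΔ : Δ (quadraticMap A) x = 0 := by
      ext i
      rw [laplacian_quadraticMap, htr, mul_zero]
      rfl
    rw [laplacian_comp (contDiff_inner_apply_self C).contDiffAt
      (contDiff_quadraticMap A).contDiffAt (stdOrthonormalBasis ℝ _), hΔ, map_zero, add_zero] at h2
    simp only [iteratedFDeriv_two_inner_apply_self, ← Finset.mul_sum] at h2
    exact (mul_eq_zero.mp h2).resolve_left two_ne_zero
  have hsum : ∀ i j x,
      ∑ a, inner ℝ (elementaryEnd i j (fderiv ℝ (quadraticMap A) x (stdOrthonormalBasis ℝ _ a)))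
        (fderiv ℝ (quadraticMap A) x (stdOrthonormalBasis ℝ _ a)) =
          4 * inner ℝ (A i x) (A j x) := by
    intro i j x
    rw [← (stdOrthonormalBasis ℝ (EuclideanSpace ℝ (Fin m))).sum_inner_mul_inner, Finset.mul_sum]
    refine Finset.sum_congr rfl fun a _ => ?_
    rw [inner_elementaryEnd, fderiv_quadraticMap hA, fderiv_quadraticMap hA,
      real_inner_comm (stdOrthonormalBasis ℝ _ a) (A j x)]
    ring
  have hoff : ∀ i j, i ≠ j → ∀ x, inner ℝ (A i x) (A j x) = 0 := by
    intro i j hij x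
    have h1 := hkey (elementaryEnd i j) (by rw [trace_elementaryEnd, if_neg hij]) x
    rw [hsum] at h1
    linarith
  have hdiag : ∀ i j x, inner ℝ (A i x) (A i x) = inner ℝ (A j x) (A j x) := by
    intro i j x
    have h1 := hkey (elementaryEnd i i - elementaryEnd j j) (by
      rw [map_sub, trace_elementaryEnd, trace_elementaryEnd]; simp) x
    simp only [LinearMap.sub_apply, inner_sub_left, Finset.sum_sub_distrib, hsum] at h1
    linarith
  -- The pointwise identities pass to endomorphisms because a symmetric endomorphism is determined
  -- by its quadratic form.
  have hsymm : ∀ i j, (A i * A j + A j * A i).IsSymmetric := by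
    intro i j x y
    simp only [LinearMap.add_apply, Module.End.mul_apply, inner_add_left, inner_add_right]
    rw [hA i, hA j, hA j, hA i, add_comm]
  have hquad : ∀ i j x, inner ℝ ((A i * A j + A j * A i) x) x = 2 * inner ℝ (A i x) (A j x) := by
    intro i j x
    simp only [LinearMap.add_apply, Module.End.mul_apply, inner_add_left]
    rw [hA i (A j x) x, hA j (A i x) x, real_inner_comm (A i x) (A j x), two_mul]
  refine ⟨hne, hA, htr, fun i j => ?_⟩
  split_ifs with hij
  · subst hij
    rw [two_smul, ← sub_eq_zero]
    refine ((hsymm i i).sub (hsymm i₀ i₀)).inner_map_self_eq_zero.mp fun x => ?_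
    rw [LinearMap.sub_apply, inner_sub_left, hquad, hquad, hdiag i i₀, sub_self]
  · rw [zero_smul]
    refine (hsymm i j).inner_map_self_eq_zero.mp fun x => ?_
    rw [hquad, hoff i j hij, mul_zero]

end QuadraticMap

/-! ### Passage between quadratic harmonic morphisms and harmonic families -/

namespace QuadraticHarmonicMorphisms

variable {m n : ℕ}

theorem quadraticMap_mem (hn : 0 < n) {A : Fin n → Module.End ℝ (EuclideanSpace ℝ (Fin m))}
    {S : Module.End ℝ (EuclideanSpace ℝ (Fin m))} (h : IsHarmonicFamily A S) :
    quadraticMap A ∈ QuadraticHarmonicMorphisms m n := by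
  refine ⟨h.isHarmonicMorphism, fun i =>
    ⟨LinearMap.BilinMap.toQuadraticMap (innerₗ (EuclideanSpace ℝ (Fin m)) ∘ₗ A i), fun x => rfl⟩,
    fun h0 => h.ne_zero ?_⟩
  have h1 : A ⟨0, hn⟩ = 0 := (h.isSymmetric ⟨0, hn⟩).inner_map_self_eq_zero.mp fun x =>
    congrArg (fun y : EuclideanSpace ℝ (Fin n) => y ⟨0, hn⟩) (congrFun h0 x)
  rw [← h.mul_self ⟨0, hn⟩, h1, mul_zero]

theorem exists_isSymmetric (Q : QuadraticForm ℝ (EuclideanSpace ℝ (Fin m))) :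
    ∃ A : Module.End ℝ (EuclideanSpace ℝ (Fin m)), A.IsSymmetric ∧ ∀ x, Q x = inner ℝ (A x) x := by
  let B := QuadraticMap.associated (R := ℝ) Q
  let A : Module.End ℝ (EuclideanSpace ℝ (Fin m)) :=
    ((InnerProductSpace.toDual ℝ (EuclideanSpace ℝ (Fin m))).symm.toLinearEquiv.toLinearMap ∘ₗ
      LinearMap.toContinuousLinearMap.toLinearMap) ∘ₗ B
  have hAB : ∀ x y, inner ℝ (A x) y = B x y := fun x y => by
    simp [A, InnerProductSpace.toDual_symm_apply]
  refine ⟨A, fun x y => ?_, fun x => ?_⟩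
  · rw [hAB, real_inner_comm, hAB]
    exact QuadraticMap.associated_isSymm ℝ Q x y
  · rw [hAB]
    exact (QuadraticMap.associated_eq_self_apply ℝ Q x).symm

theorem exists_eq_quadraticMap {φ : EuclideanSpace ℝ (Fin m) → EuclideanSpace ℝ (Fin n)}
    (h : φ ∈ QuadraticHarmonicMorphisms m n) :
    0 < n ∧ ∃ A S, IsHarmonicFamily A S ∧ φ = quadraticMap A := by
  obtain ⟨hφ, hQ, hne⟩ := h
  choose Q hQ using hQ
  choose A hA hQA using fun i => exists_isSymmetric (Q i)
  obtain rfl : φ = quadraticMap A := by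
    ext x i
    rw [hQ, hQA, quadraticMap_apply]
  obtain ⟨i, hi⟩ : ∃ i, A i ≠ 0 := by
    by_contra! h0
    exact hne (by ext x i; simp [quadraticMap_apply, h0])
  -- Here `S` is the square of a non-zero `A i`. It is non-zero since ⟨A²x, x⟩ = ‖Ax‖² for symmetric
  -- A.
  refine ⟨i.pos, A, _, hφ.isHarmonicFamily hA i fun h0 => hi ?_, rfl⟩
  ext1 x
  rw [LinearMap.zero_apply, ← inner_self_eq_zero (𝕜 := ℝ), hA i, ← Module.End.mul_apply, h0,
    LinearMap.zero_apply, inner_zero_right]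

end QuadraticHarmonicMorphisms

/-! Range-extendability of quadratic harmonic morphisms -/

namespace IsHarmonicFamily

variable {E V : Type*} [NormedAddCommGroup E] [InnerProductSpace ℝ E] [FiniteDimensional ℝ E]
  [NormedAddCommGroup V] [InnerProductSpace ℝ V] [FiniteDimensional ℝ V]
  {n k : ℕ} {A : Fin n → Module.End ℝ V} {S : Module.End ℝ V}

theorem comp_injective (h : IsHarmonicFamily A S) {f : Fin k → Fin n}
    (hf : Function.Injective f) : IsHarmonicFamily (fun i => A (f i)) S :=
  ⟨h.ne_zero, fun i => h.isSymmetric _, fun i => h.trace_eq_zero _, fun i j => by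
    rw [h.anticommute]; simp [hf.eq_iff]⟩

/-- The compression of a harmonic family to a non-zero invariant subspace on which `S` is
injective. -/
theorem compression [Nontrivial E] (h : IsHarmonicFamily A S) (hn : 2 ≤ n) (e : E →ₗᵢ[ℝ] V)
    (he : ∀ i x, A i (e x) ∈ LinearMap.range e.toLinearMap)
    (hS : ∀ x, S (e x) = 0 → x = 0) :
    IsHarmonicFamily (fun i => compression e (A i)) (compression e S) := by
  have hrel : ∀ i j, _root_.compression e (A i) * _root_.compression e (A j) +
      _root_.compression e (A j) * _root_.compression e (A i) =
        (if i = j then (2 : ℝ) else 0) • _root_.compression e S := fun i j => by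
    rw [compression_mul _ (he j), compression_mul _ (he i), ← compression_add, h.anticommute,
      compression_smul]
  have hunit : ∀ i, IsUnit (_root_.compression e (A i)) := fun i => by
    rw [LinearMap.isUnit_iff_ker_eq_bot, LinearMap.ker_eq_bot']
    intro x hx
    apply hS
    rw [← h.mul_self i, Module.End.mul_apply, ← apply_compression (he i), hx, map_zero, map_zero]
  refine ⟨fun h0 => ?_, fun i => ?_, fun i => ?_, hrel⟩
  · have h1 := hrel ⟨0, by omega⟩ ⟨0, by omega⟩
    rw [h0, smul_zero, ← two_smul ℝ, smul_eq_zero] at h1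
    exact ((hunit _).mul (hunit _)).ne_zero (h1.resolve_left two_ne_zero)
  · exact (h.isSymmetric i).adjoint_conj e.toLinearMap
  -- A vanishing trace need not survive restriction to a subspace. It is recovered from an
  -- invertible member that anticommutes with the `i`-th, hence the bound 2 ≤ n.
  · obtain ⟨j, hj⟩ : ∃ j, i ≠ j := by
      have : Nontrivial (Fin n) := Fin.nontrivial_iff_two_le.mpr hn
      exact (exists_ne i).imp fun _ => Ne.symm
    exact trace_eq_zero_of_anticommute (hunit j) (by rw [hrel, if_neg hj, zero_smul])

end IsHarmonicFamily

theorem IsCliffordFamily.isHarmonicFamily {V : Type*} [NormedAddCommGroup V]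
    [InnerProductSpace ℝ V] [FiniteDimensional ℝ V] [Nontrivial V] {n : ℕ} (hn : 2 ≤ n)
    {P : Fin n → Module.End ℝ V} (h : IsCliffordFamily 1 P) {c : ℝ} (hc : c ≠ 0) :
    IsHarmonicFamily (fun i => c • P i) ((c * c) • 1) := by
  refine ⟨smul_ne_zero (mul_ne_zero hc hc) one_ne_zero, fun i => ?_, fun i => ?_, fun i j => ?_⟩
  · rw [LinearMap.isSymmetric_iff_isSelfAdjoint, LinearMap.isSelfAdjoint_iff', map_smul, h.1,
      one_smul]
  · obtain ⟨j, hj⟩ : ∃ j, i ≠ j := by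
      have : Nontrivial (Fin n) := Fin.nontrivial_iff_two_le.mpr hn
      exact (exists_ne i).imp fun _ => Ne.symm
    have hunit : IsUnit (P j) :=
      ⟨⟨P j, P j, by rw [h.mul_self, one_smul], by rw [h.mul_self, one_smul]⟩, rfl⟩
    rw [map_smul, trace_eq_zero_of_anticommute hunit (by rw [h.2, if_neg hj, zero_smul]),
      smul_zero]
  · rw [smul_mul_smul_comm, smul_mul_smul_comm, ← smul_add, h.2, smul_smul, smul_smul, mul_one,
      mul_comm]

namespace QuadraticHarmonicMorphisms

variable {m n : ℕ}

/-- Truncation stays non-zero because every member has the same square S ≠ 0. Length 0 is excluded,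
as the only map to ℝ⁰ is zero. -/
theorem nonempty_of_le {k : ℕ} (hk : 0 < k) (hkn : k ≤ n)
    (h : (QuadraticHarmonicMorphisms m n).Nonempty) :
    (QuadraticHarmonicMorphisms m k).Nonempty := by
  obtain ⟨φ, hφ⟩ := h
  obtain ⟨-, A, S, hA, -⟩ := exists_eq_quadraticMap hφ
  exact ⟨_, quadraticMap_mem hk (hA.comp_injective (Fin.castLE_injective hkn))⟩

theorem bddAbove (m : ℕ) : BddAbove {k : ℕ | (QuadraticHarmonicMorphisms m k).Nonempty} := by
  refine ⟨Module.finrank ℝ (Module.End ℝ (EuclideanSpace ℝ (Fin m))), ?_⟩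
  rintro k ⟨φ, hφ⟩
  obtain ⟨-, A, S, hA, -⟩ := exists_eq_quadraticMap hφ
  simpa using card_le_of_anticommute hA.ne_zero hA.anticommute

/-- Domain-minimal quadratic harmonic morphisms are umbilical: up to a factor they come from
irreducible Clifford systems. -/
theorem IsDomainMinimal.exists_isCliffordFamily (hn : 2 ≤ n)
    {φ : EuclideanSpace ℝ (Fin m) → EuclideanSpace ℝ (Fin n)} (h : IsDomainMinimal φ) :
    Nontrivial (EuclideanSpace ℝ (Fin m)) ∧
      ∃ (c : ℝ) (P : Fin n → Module.End ℝ (EuclideanSpace ℝ (Fin m))), c ≠ 0 ∧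
        IsCliffordFamily 1 P ∧ IsIrreducibleFamily P ∧ φ = quadraticMap (fun i => c • P i) := by
  obtain ⟨hn0, A, S, hA, rfl⟩ := exists_eq_quadraticMap h.1
  have hS := hA.isSymmetric_square hn0
  -- Minimality of m, in usable form: compression to `U` is a harmonic family as soon as `S` is
  -- injective there, so such a `U` is everything.
  have hmin : ∀ U : Submodule ℝ (EuclideanSpace ℝ (Fin m)), (∀ i, ∀ x ∈ U, A i x ∈ U) → U ≠ ⊥ →
      (∀ x ∈ U, S x = 0 → x = 0) → U = ⊤ := by
    intro U hU hbot hinj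
    obtain ⟨d, e, hd, he⟩ := U.exists_linearIsometry_range_eq
    have hd0 : 0 < d := by
      rw [Nat.pos_iff_ne_zero, ← hd]
      exact fun h0 => hbot (Submodule.finrank_eq_zero.mp h0)
    have := EuclideanSpace.nontrivial_fin hd0
    have hc := hA.compression hn e (fun i x => by rw [he]; exact hU i _ (he.le ⟨x, rfl⟩))
      fun x hx => (map_eq_zero_iff e e.injective).mp (hinj _ (he.le ⟨x, rfl⟩) hx)
    have hle := h.2.2 ⟨_, quadraticMap_mem hn0 hc⟩
    apply Submodule.eq_top_of_finrank_eq
    apply le_antisymm U.finrank_le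
    rw [hd]
    simpa using hle
  have hcomm : ∀ i x, S (A i x) = A i (S x) := fun i x => LinearMap.congr_fun (hA.commute i) x
  -- As `S` is symmetric, its range meets its kernel trivially, so `hmin` applies to the range. Once
  -- `S` is invertible, `hmin` applies to every non-zero invariant subspace and gives
  -- irreducibility.
  have hrange : LinearMap.range S = ⊤ := by
    refine hmin _ ?_ (fun h0 => hA.ne_zero (LinearMap.range_eq_bot.mp h0)) ?_
    · rintro i _ ⟨x, rfl⟩
      exact ⟨A i x, hcomm i x⟩
    · rintro _ ⟨x, rfl⟩ hx
      rw [← inner_self_eq_zero (𝕜 := ℝ), hS, hx, inner_zero_right]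
  have hker : LinearMap.ker S = ⊥ := LinearMap.ker_eq_bot_iff_range_eq_top.mpr hrange
  have hirr : IsIrreducibleFamily A := fun U hU => or_iff_not_imp_left.mpr fun hbot =>
    hmin U hU hbot fun x _ hx => LinearMap.ker_eq_bot'.mp hker x hx
  have hnt : Nontrivial (EuclideanSpace ℝ (Fin m)) := by
    by_contra hsub
    rw [not_nontrivial_iff_subsingleton] at hsub
    exact hA.ne_zero (Subsingleton.elim _ _)
  obtain ⟨c, hc⟩ := hirr.exists_eq_smul_one hS hcomm
  have hc0 : 0 < c := by
    obtain ⟨x, hx⟩ := exists_ne (0 : EuclideanSpace ℝ (Fin m))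
    have h1 := hA.inner_apply_apply ⟨0, hn0⟩ ⟨0, hn0⟩ x
    rw [if_pos rfl, hc, LinearMap.smul_apply, Module.End.one_apply, inner_smul_left,
      real_inner_self_eq_norm_sq, real_inner_self_eq_norm_sq] at h1
    simp only [conj_trivial] at h1
    have h2 : 0 ≤ c := nonneg_of_mul_nonneg_left (h1 ▸ sq_nonneg _) (by positivity)
    refine lt_of_le_of_ne h2 fun h0 => hA.ne_zero ?_
    rw [hc, ← h0, zero_smul]
  have hs : √c ≠ 0 := (Real.sqrt_pos.mpr hc0).ne'
  refine ⟨hnt, √c, fun i => (√c)⁻¹ • A i, hs, ⟨fun i => ?_, fun i j => ?_⟩, fun U hU => ?_, ?_⟩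
  · rw [map_smulₛₗ, (hA.isSymmetric i).adjoint_eq, one_smul]
    rfl
  · rw [smul_mul_smul_comm, smul_mul_smul_comm, ← smul_add, hA.anticommute, hc, smul_smul,
      smul_smul]
    congr 1
    have h3 : (√c)⁻¹ * (√c)⁻¹ * c = 1 := by
      rw [← mul_inv, Real.mul_self_sqrt hc0.le, inv_mul_cancel₀ hc0.ne']
    split_ifs
    · linear_combination 2 * h3
    · ring
  · refine hirr U fun i x hx => ?_
    have := U.smul_mem (√c) (hU i x hx)
    rwa [LinearMap.smul_apply, smul_inv_smul₀ hs] at this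
  · simp only [smul_inv_smul₀ hs]

theorem IsDomainMinimal.exists_gt {φ : EuclideanSpace ℝ (Fin m) → EuclideanSpace ℝ (Fin n)}
    (h : IsDomainMinimal φ) (hφ : ¬ IsRangeMaximal φ) :
    ∃ k, n < k ∧ IsGreatest {k : ℕ | (QuadraticHarmonicMorphisms m k).Nonempty} k :=
  exists_gt_isGreatest ⟨φ, h.1⟩ (bddAbove m) fun hg => hφ ⟨h.1, hg⟩

theorem IsDomainMinimal.exists_extension_of_two_le (hn : 2 ≤ n)
    {φ : EuclideanSpace ℝ (Fin m) → EuclideanSpace ℝ (Fin n)}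
    (h : IsDomainMinimal φ) (hφ : ¬ IsRangeMaximal φ) :
    ∃ (k : ℕ) (h : n < k) (ψ : EuclideanSpace ℝ (Fin m) → EuclideanSpace ℝ (Fin k)),
      IsRangeMaximal ψ ∧
        ∀ (i : Fin n) (x : EuclideanSpace ℝ (Fin m)), ψ x (Fin.castLE h.le i) = φ x i := by
  obtain ⟨k, hk, hg⟩ := h.exists_gt hφ
  obtain ⟨φ', hφ'⟩ := hg.1
  -- The longer morphism is domain-minimal too, since truncating one from a smaller space would
  -- contradict the minimality of m for n. Hence it also comes from a Clifford system; its scale is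
  -- discarded in favour of that of φ.
  have hmin' : IsDomainMinimal φ' :=
    ⟨hφ', ⟨φ', hφ'⟩, fun d hd => h.2.2 (nonempty_of_le (by omega) hk.le hd)⟩
  obtain ⟨-, _, P', -, hP', -, -⟩ := hmin'.exists_isCliffordFamily (by omega)
  obtain ⟨hnt, c, P, hc, hP, hirr, rfl⟩ := h.exists_isCliffordFamily hn
  obtain ⟨R, hR, hRP⟩ := hP.exists_extension (one_mul 1) hk hirr hP'
  refine ⟨k, hk, quadraticMap (fun i => c • R i),
    ⟨quadraticMap_mem (by omega) (hR.isHarmonicFamily (by omega) hc), hg⟩, fun i x => ?_⟩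
  rw [quadraticMap_apply, quadraticMap_apply, hRP]

theorem exists_isSymmetric_trace_eq_zero :
    ∃ A : Module.End ℝ (EuclideanSpace ℝ (Fin 2)), A.IsSymmetric ∧ LinearMap.trace ℝ _ A = 0 ∧
      A * A ≠ 0 := by
  refine ⟨Matrix.toEuclideanLin !![1, 0; 0, -1], ?_, ?_, ?_⟩
  · rw [Matrix.isSymmetric_toEuclideanLin_iff]
    ext i j
    fin_cases i <;> fin_cases j <;> simp
  · rw [trace_toEuclideanLin_fin_two]
    simp
  · intro h
    rw [toEuclideanLin_mul, LinearEquiv.map_eq_zero_iff] at h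
    simpa using congrFun (congrFun h 0) 0

/-- In dimension at most one a traceless endomorphism vanishes, while diag(1, -1) gives an example
on the plane. -/
theorem IsDomainMinimal.eq_two {φ : EuclideanSpace ℝ (Fin m) → EuclideanSpace ℝ (Fin 1)}
    (h : IsDomainMinimal φ) : m = 2 := by
  have hle : m ≤ 2 := by
    obtain ⟨A, hA, htr, hne⟩ := exists_isSymmetric_trace_eq_zero
    refine h.2.2 ⟨_, quadraticMap_mem (A := fun _ => A) (S := A * A) one_pos
      ⟨hne, fun _ => hA, fun _ => htr, fun i j => ?_⟩⟩
    rw [Subsingleton.elim i j, if_pos rfl, two_smul]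
  obtain ⟨-, A, S, hA, -⟩ := exists_eq_quadraticMap h.1
  by_contra hm
  refine hA.ne_zero ?_
  have hm' : m = 0 ∨ m = 1 := by omega
  rcases hm' with rfl | rfl
  · exact Subsingleton.elim _ _
  · have htr := hA.trace_eq_zero 0
    have hA0 : A 0 = 0 := by
      rw [LinearMap.trace_eq_sum_inner (A 0) (EuclideanSpace.basisFun (Fin 1) ℝ)] at htr
      apply (EuclideanSpace.basisFun (Fin 1) ℝ).toBasis.ext
      intro i
      rw [Subsingleton.elim i 0]
      ext j
      rw [Subsingleton.elim j 0]
      simpa [EuclideanSpace.inner_single_left] using htr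
    rw [← hA.mul_self 0, hA0, mul_zero]

theorem IsDomainMinimal.exists_extension
    {φ : EuclideanSpace ℝ (Fin m) → EuclideanSpace ℝ (Fin n)}
    (h : IsDomainMinimal φ) (hφ : ¬ IsRangeMaximal φ) :
    ∃ (k : ℕ) (h : n < k) (ψ : EuclideanSpace ℝ (Fin m) → EuclideanSpace ℝ (Fin k)),
      IsRangeMaximal ψ ∧
        ∀ (i : Fin n) (x : EuclideanSpace ℝ (Fin m)), ψ x (Fin.castLE h.le i) = φ x i := by
  obtain ⟨hn0, A, S, hA, hφA⟩ := exists_eq_quadraticMap h.1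
  rcases Nat.lt_or_ge n 2 with hn | hn
  swap
  · exact h.exists_extension_of_two_le hn hφ
  obtain rfl : n = 1 := by omega
  obtain rfl := h.eq_two
  obtain ⟨B, hB, htrB, hAB, hBB⟩ := exists_anticommuting_of_trace_eq_zero (A 0)
    (hA.isSymmetric 0) (hA.trace_eq_zero 0)
  have hfam : IsHarmonicFamily ![A 0, B] S := by
    refine ⟨hA.ne_zero, fun i => ?_, fun i => ?_, fun i j => ?_⟩
    · fin_cases i
      · exact hA.isSymmetric 0
      · exact hB
    · fin_cases i
      · exact hA.trace_eq_zero 0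
      · exact htrB
    · fin_cases i <;> fin_cases j <;>
        simp [hBB, hA.mul_self, hAB, add_comm (B * A 0), two_smul]
  have hmem := quadraticMap_mem two_pos hfam
  have hcomp : ∀ x, quadraticMap ![A 0, B] x 0 = φ x 0 := fun x => by rw [hφA]; rfl
  by_cases hmax : IsRangeMaximal (quadraticMap ![A 0, B])
  · refine ⟨2, by norm_num, _, hmax, fun i x => ?_⟩
    rw [Subsingleton.elim i 0]
    exact hcomp x
  -- The pair is domain-minimal because a smaller domain for n = 2 would, by truncation, be a
  -- smaller domain for n = 1.
  · obtain ⟨k, hk, ψ, hψ, hψφ⟩ := IsDomainMinimal.exists_extension_of_two_le le_rfl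
      ⟨hmem, ⟨_, hmem⟩, fun d hd => h.2.2 (nonempty_of_le one_pos one_le_two hd)⟩ hmax
    refine ⟨k, by omega, ψ, hψ, fun i x => ?_⟩
    rw [Subsingleton.elim i 0, ← hcomp x]
    exact hψφ 0 x

end QuadraticHarmonicMorphisms

theorem theorem5p4 :
    (∀ (m n : ℕ) (φ : EuclideanSpace ℝ (Fin m) → EuclideanSpace ℝ (Fin n)),
      QuadraticHarmonicMorphisms.IsDomainMinimal φ →
      ¬ QuadraticHarmonicMorphisms.IsRangeMaximal φ →
      ∃ (k : ℕ) (h : n < k) (ψ : EuclideanSpace ℝ (Fin m) → EuclideanSpace ℝ (Fin k)),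
        QuadraticHarmonicMorphisms.IsRangeMaximal ψ ∧
        ∀ (i : Fin n) (x : EuclideanSpace ℝ (Fin m)), ψ x (Fin.castLE h.le i) = φ x i) ∧
    (∀ (m n : ℕ) (P : Fin n → Module.End ℝ (EuclideanSpace ℝ (Fin (2 * m)))),
      (n = 1 → ∀ i, LinearMap.trace ℝ (EuclideanSpace ℝ (Fin (2 * m))) (P i) = 0) →
      CliffordSystems.IsDomainMinimal P →
      ¬ CliffordSystems.IsRangeMaximal P →
      ∃ (k : ℕ) (h : n < k) (R : Fin k → Module.End ℝ (EuclideanSpace ℝ (Fin (2 * m)))),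
        CliffordSystems.IsRangeMaximal R ∧ ∀ i : Fin n, R (Fin.castLE h.le i) = P i) ∧
    (∀ (m n : ℕ) (τ : Fin n → Module.End ℝ (EuclideanSpace ℝ (Fin m))),
      OSystems.IsDomainMinimal τ →
      ¬ OSystems.IsRangeMaximal τ →
      ∃ (k : ℕ) (h : n < k) (ρ : Fin k → Module.End ℝ (EuclideanSpace ℝ (Fin m))),
        OSystems.IsRangeMaximal ρ ∧ ∀ i : Fin n, ρ (Fin.castLE h.le i) = τ i) := by
  exact ⟨fun _ _ _ h hφ => h.exists_extension hφ, fun _ _ _ htr h hP => h.exists_extension htr hP,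
    fun _ _ _ h hτ => h.exists_extension hτ⟩
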